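/- Let $R$ be a Dedekind domain (fields are allowed) and let $M$ be an $R$-module. A subset $X \subseteq M$ is a weak basis of $M$ if it generates $M$ and $x \notin \operatorname{Span}(X \setminus \{x\})$ for every $x \in X$. The module $M$ is regularly weakly based if every generating set of $M$ contains a weak basis of $M$. A module $B$ is torsion if each of its elements is annihilated by some non-zero element of $R$, and bounded if $IB = 0$ for some non-zero ideal $I$ of $R$. (1) If $M$ is regularly weakly based, then $M = P \oplus B$ for some submodules $P, B$ of $M$ with $P$ projective and $B$ a bounded torsion module. (2) Let $T$ be the torsion submodule of $M$, that is, the set of all torsion elements of $M$. If $M/T$ is not projective, then $M$ has a generating set that contains no weak basis of $M$. -/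

import Mathlib

/-- A subset `X` of a module is weakly independent if no `x ∈ X` lies in the span of
`X \ {x}`. -/
def IsWeaklyIndependent (R : Type*) {M : Type*} [Ring R] [AddCommGroup M] [Module R M]
    (X : Set M) : Prop :=
  ∀ x ∈ X, x ∉ Submodule.span R (X \ {x})

/-- A weak basis of a module is a weakly independent generating subset. -/
def IsWeakBasis (R : Type*) {M : Type*} [Ring R] [AddCommGroup M] [Module R M]
    (X : Set M) : Prop :=
  Submodule.span R X = ⊤ ∧ IsWeaklyIndependent R X

/-- A module is regularly weakly based if every generating subset contains a weak basis. -/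
def IsRegularlyWeaklyBased (R M : Type*) [Ring R] [AddCommGroup M] [Module R M] : Prop :=
  ∀ X : Set M, Submodule.span R X = ⊤ → ∃ W : Set M, W ⊆ X ∧ IsWeakBasis R W

/-- A module is bounded if it is annihilated by some non-zero ideal. -/
def IsBoundedModule (R M : Type*) [CommRing R] [AddCommGroup M] [Module R M] : Prop :=
  ∃ I : Ideal R, I ≠ ⊥ ∧ ∀ a ∈ I, ∀ m : M, a • m = 0

/-! ### Bad generating sets, and quotients that stay regularly weakly based -/

section WeakBases

variable {R M : Type*} [CommRing R] [AddCommGroup M] [Module R M]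

/-! The obstruction is an ascending chain of cyclic submodules that exhausts `M` modulo some `N`
although no single term does. Prüfer modules R(p^∞) and infinite sums of R/pₙ over distinct primes
have such chains. A chain in R(p^∞) need not lift along a surjection from `M`, so `M` is first
replaced by a quotient with aM = M, where division by a lifts it; hence no regularly weakly based
module maps onto R(p^∞) (`not_surjective_prufer`).

R(p^∞) is injective and its proper submodules are bounded, so maps into it are easy to build and
become onto once unbounded. Thus a regularly weakly based torsion module is bounded at each p; the
R/pₙ chains leave only finitely many p, so it is bounded. If R is not a field, `M` has finite rank:
some finitely generated free G has M/G torsion. M/G is again regularly weakly based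
(`quotient_of_fg`), so bM ⊆ G with b ≠ 0. Multiplication by b has kernel T and embeds M/T in G, so
M/T is projective, T splits off and bT = 0. -/

theorem not_isRegularlyWeaklyBased_of_chain (N : Submodule R M) (x : ℕ → M)
    (hx : ∀ n, x n ∈ Submodule.span R {x (n + 1)})
    (htop : N ⊔ Submodule.span R (Set.range x) = ⊤)
    (hne : ∀ n, N ⊔ Submodule.span R {x n} ≠ ⊤) : ¬ IsRegularlyWeaklyBased R M := by
  intro h
  have hmono : ∀ i j, i ≤ j → x i ∈ Submodule.span R {x j} := by
    intro i j hij
    induction hij with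
    | refl => exact Submodule.mem_span_singleton_self _
    | step _ ih =>
      exact (Submodule.span_singleton_le_iff_mem _ _).2 (hx _) ih
  obtain ⟨W, hWX, hWtop, hW⟩ := h ((N : Set M) ∪ Set.range x) (by
    rw [Submodule.span_union, Submodule.span_eq, htop])
  -- A single chain element in `W` would not suffice to generate, yet of two distinct ones the
  -- earlier is a multiple of the later.
  have key : ∀ i, ∃ j, x j ∈ W ∧ x j ≠ x i := by
    intro i
    by_contra! hc
    refine hne i (top_unique (hWtop ▸ Submodule.span_le.2 fun w hw ↦ ?_))
    rcases hWX hw with hN | ⟨j, rfl⟩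
    · exact Submodule.mem_sup_left hN
    · rw [hc j hw]
      exact Submodule.mem_sup_right (Submodule.mem_span_singleton_self _)
  have red : ∀ i j, x i ∈ W → x j ∈ W → x j ≠ x i → ¬ i ≤ j := fun i j hi hj hji hij ↦
    hW _ hi (Submodule.span_mono
      (Set.singleton_subset_iff.2 (show x j ∈ W \ {x i} from ⟨hj, hji⟩)) (hmono i j hij))
  obtain ⟨i, hi, -⟩ := key 0
  obtain ⟨j, hj, hji⟩ := key i
  rcases le_total i j with hij | hij
  · exact red i j hi hj hji hij
  · exact red j i hj hi hji.symm hij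

theorem Submodule.span_lifts_sup_eq_top (N : Submodule R M) (s : M ⧸ N → M)
    (hs : ∀ z, N.mkQ (s z) = z) (Z : Set (M ⧸ N)) (hZ : Submodule.span R Z = ⊤) :
    Submodule.span R (s '' Z) ⊔ N = ⊤ := by
  have hZs : N.mkQ '' (s '' Z) = Z := by
    rw [Set.image_image]; simp only [hs, Set.image_id']
  have : Submodule.comap N.mkQ (Submodule.map N.mkQ (Submodule.span R (s '' Z))) = ⊤ := by
    rw [Submodule.map_span, hZs, hZ, Submodule.comap_top]
  rwa [Submodule.comap_map_eq, N.ker_mkQ] at this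

/-- Lifting `Z` into `Q` forces, by minimality, all of `V` into the weak basis `W`; the rest of `W`
is then weakly independent modulo the span of `V`. -/
theorem IsRegularlyWeaklyBased.quotient_of_minimal {M : Type*} [AddCommGroup M] [Module R M]
    (h : IsRegularlyWeaklyBased R M) (N Q : Submodule R M)
    (V : Set M) (hN : N = Submodule.span R V) (hV : Submodule.span R V ⊔ Q = ⊤)
    (hmin : ∀ V' ⊆ V, Submodule.span R V' ⊔ Q = ⊤ → V' = V) :
    IsRegularlyWeaklyBased R (M ⧸ N) := by
  intro Z hZ
  rw [← hN] at hV
  have hlift : ∀ z : M ⧸ N, ∃ y ∈ Q, N.mkQ y = z := by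
    intro z
    obtain ⟨m, rfl⟩ := N.mkQ_surjective z
    obtain ⟨n, hn, q, hq, rfl⟩ := Submodule.mem_sup.1 (hV ▸ Submodule.mem_top : m ∈ N ⊔ Q)
    exact ⟨q, hq, by simpa using hn⟩
  choose s hsQ hs using hlift
  obtain ⟨W, hWX, hWtop, hW⟩ := h (V ∪ s '' Z) (by
    rw [Submodule.span_union, ← hN, sup_comm, N.span_lifts_sup_eq_top s hs Z hZ])
  have hVW : V ⊆ W := by
    have := hmin (V ∩ W) Set.inter_subset_left (top_unique (hWtop ▸ Submodule.span_le.2 ?_))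
    · exact Set.inter_eq_left.1 this
    · intro w hw
      rcases hWX hw with hwV | ⟨z, -, rfl⟩
      · exact Submodule.mem_sup_left (Submodule.subset_span ⟨hwV, hw⟩)
      · exact Submodule.mem_sup_right (hsQ z)
  refine ⟨N.mkQ '' (W \ V), ?_, ?_, ?_⟩
  · rintro _ ⟨w, ⟨hw, hwV⟩, rfl⟩
    rcases hWX hw with h | ⟨z, hz, rfl⟩
    · exact absurd h hwV
    · rwa [hs]
  · rw [← Submodule.map_span]
    refine top_unique ?_
    rw [← Submodule.range_mkQ N, ← Submodule.map_top, ← hWtop, Submodule.map_span_le]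
    intro w hw
    by_cases hwV : w ∈ V
    · have : N.mkQ w = 0 := by simpa [hN] using Submodule.subset_span hwV
      rw [this]; exact zero_mem _
    · exact Submodule.mem_map_of_mem (Submodule.subset_span ⟨hw, hwV⟩)
  · rintro _ ⟨w, ⟨hw, hwV⟩, rfl⟩ hmem
    have h1 : N.mkQ '' (W \ V) \ {N.mkQ w} ⊆ N.mkQ '' (W \ {w}) := by
      rintro _ ⟨⟨w', ⟨hw', -⟩, rfl⟩, hne⟩
      exact ⟨w', ⟨hw', fun h ↦ hne (by rw [Set.mem_singleton_iff.1 h]; rfl)⟩, rfl⟩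
    have h2 := Submodule.span_mono h1 hmem
    rw [← Submodule.map_span, ← Submodule.mem_comap, Submodule.comap_map_eq, N.ker_mkQ] at h2
    have h3 : N ≤ Submodule.span R (W \ {w}) := hN ▸ Submodule.span_mono fun v hv ↦
      ⟨hVW hv, fun h ↦ hwV (Set.mem_singleton_iff.1 h ▸ hv)⟩
    rw [sup_eq_left.2 h3] at h2
    exact hW w hw h2

/-- A finite set generating `M` modulo `Q` contains a minimal one. -/
theorem exists_minimal_finset_span_sup (Q : Submodule R M) (E : Finset M)
    (h : Submodule.span R (E : Set M) ⊔ Q = ⊤) :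
    ∃ E' : Finset M, E' ⊆ E ∧ Submodule.span R (E' : Set M) ⊔ Q = ⊤ ∧
      ∀ e ∈ E', e ∉ Submodule.span R ((E' : Set M) \ {e}) ⊔ Q := by
  classical
  induction E using Finset.strongInduction with
  | H E ih =>
    by_cases hc : ∀ e ∈ E, e ∉ Submodule.span R ((E : Set M) \ {e}) ⊔ Q
    · exact ⟨E, subset_rfl, h, hc⟩
    · push Not at hc
      obtain ⟨e, he, hmem⟩ := hc
      obtain ⟨E', hE', h1, h2⟩ := ih (E.erase e) (Finset.erase_ssubset he) (by
        refine top_unique (h ▸ sup_le (Submodule.span_le.2 fun x hx ↦ ?_) le_sup_right)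
        rw [Finset.coe_erase]
        by_cases hxe : x = e
        · exact hxe ▸ hmem
        · exact Submodule.mem_sup_left (Submodule.subset_span ⟨hx, hxe⟩))
      exact ⟨E', hE'.trans (Finset.erase_subset _ _), h1, h2⟩

/-- A finite `F ⊆ W` spans `G`. Outside `F` weak independence survives modulo `G`; the finitely many
images from `F` are then thinned out to a minimal supplement. -/
theorem IsRegularlyWeaklyBased.quotient_of_fg {M : Type*} [AddCommGroup M] [Module R M]
    (h : IsRegularlyWeaklyBased R M) (G : Submodule R M) (hG : G.FG) :
    IsRegularlyWeaklyBased R (M ⧸ G) := by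
  classical
  intro Z hZ
  obtain ⟨E, hE⟩ := hG
  choose s hs using G.mkQ_surjective
  obtain ⟨W, hWX, hWtop, hW⟩ := h (E ∪ s '' Z) (by
    rw [Submodule.span_union, hE, sup_comm, G.span_lifts_sup_eq_top s hs Z hZ])
  -- `F` also absorbs `E ∩ W`, so that all of `W \ F` consists of lifts from `Z`.
  obtain ⟨F, hFW, hEF, hGF⟩ : ∃ F : Finset M, (F : Set M) ⊆ W ∧ (∀ e ∈ E, e ∈ W → e ∈ F) ∧
      G ≤ Submodule.span R F := by
    have : ∀ e : M, ∃ F : Finset M, (F : Set M) ⊆ W ∧ e ∈ Submodule.span R (F : Set M) :=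
      fun e ↦ Submodule.mem_span_finite_of_mem_span (hWtop ▸ Submodule.mem_top)
    choose f hfW hf using this
    refine ⟨E.biUnion f ∪ E.filter (· ∈ W), ?_, fun e he heW ↦ by simp [he, heW], ?_⟩
    · intro x hx
      simp only [Finset.coe_union, Set.mem_union, Finset.mem_coe, Finset.mem_biUnion,
        Finset.mem_filter] at hx
      rcases hx with ⟨e, -, hx⟩ | ⟨-, hx⟩
      exacts [hfW e hx, hx]
    · rw [← hE, Submodule.span_le]
      intro e he
      refine Submodule.span_mono (fun x hx ↦ ?_) (hf e)
      simp only [Finset.coe_union, Set.mem_union, Finset.mem_coe, Finset.mem_biUnion]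
      exact Or.inl ⟨e, he, hx⟩
  have hWE : ∀ w ∈ W, w ∉ E → G.mkQ w ∈ Z := by
    intro w hw hwE
    rcases hWX hw with h | ⟨z, hz, rfl⟩
    · exact absurd h hwE
    · rwa [hs]
  set A : Set (M ⧸ G) := G.mkQ '' (W \ F) with hA
  have hAZ : A ⊆ Z := by
    rintro _ ⟨w, ⟨hw, hwF⟩, rfl⟩
    exact hWE w hw fun hwE ↦ hwF (hEF w hwE hw)
  obtain ⟨E', hE', hE'top, hE'min⟩ := exists_minimal_finset_span_sup (Submodule.span R A)
    ((F.filter (· ∉ E)).image G.mkQ) (by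
      refine top_unique ?_
      rw [← Submodule.range_mkQ G, ← Submodule.map_top, ← hWtop, Submodule.map_span_le]
      intro w hw
      by_cases hwF : w ∈ F
      · by_cases hwE : w ∈ E
        · have : G.mkQ w = 0 := by
            simpa [← hE] using Submodule.subset_span (R := R) (s := (E : Set M)) hwE
          rw [this]; exact zero_mem _
        · exact Submodule.mem_sup_left (Submodule.subset_span (by
            rw [Finset.mem_coe]
            exact Finset.mem_image_of_mem _ (Finset.mem_filter.2 ⟨hwF, hwE⟩)))
      · exact Submodule.mem_sup_right (Submodule.subset_span ⟨w, ⟨hw, hwF⟩, rfl⟩))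
  have hE'W : ∀ e ∈ E', ∃ w ∈ W, w ∉ E ∧ G.mkQ w = e := by
    intro e he
    obtain ⟨w, hw, rfl⟩ := Finset.mem_image.1 (hE' he)
    rw [Finset.mem_filter] at hw
    exact ⟨w, hFW hw.1, hw.2, rfl⟩
  have hAE' : A ∪ E' ⊆ G.mkQ '' W := by
    rintro _ (⟨w, ⟨hw, -⟩, rfl⟩ | he)
    · exact ⟨w, hw, rfl⟩
    · obtain ⟨w, hw, -, rfl⟩ := hE'W _ he
      exact ⟨w, hw, rfl⟩
  refine ⟨A ∪ E', Set.union_subset hAZ fun e he ↦ ?_, ?_, ?_⟩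
  · obtain ⟨w, hw, hwE, rfl⟩ := hE'W e he
    exact hWE w hw hwE
  · rw [Submodule.span_union, sup_comm, hE'top]
  · rintro x hx hmem
    by_cases hxE : x ∈ E'
    · refine hE'min x hxE (Submodule.span_le.2 ?_ hmem)
      rintro y ⟨hy | hy, hyx⟩
      · exact Submodule.mem_sup_right (Submodule.subset_span hy)
      · exact Submodule.mem_sup_left (Submodule.subset_span ⟨hy, hyx⟩)
    · obtain ⟨w, ⟨hw, hwF⟩, rfl⟩ := hx.resolve_right hxE
      have h1 : (A ∪ E') \ {G.mkQ w} ⊆ G.mkQ '' (W \ {w}) := by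
        rintro y ⟨hy, hne⟩
        obtain ⟨w', hw', rfl⟩ := hAE' hy
        exact ⟨w', ⟨hw', fun h ↦ hne (by rw [Set.mem_singleton_iff.1 h]; rfl)⟩, rfl⟩
      have h2 := Submodule.span_mono h1 hmem
      rw [← Submodule.map_span, ← Submodule.mem_comap, Submodule.comap_map_eq, G.ker_mkQ] at h2
      have h3 : G ≤ Submodule.span R (W \ {w}) := hGF.trans (Submodule.span_mono fun v hv ↦
        ⟨hFW hv, fun h ↦ hwF (Set.mem_singleton_iff.1 h ▸ hv)⟩)
      rw [sup_eq_left.2 h3] at h2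
      exact hW w hw h2

end WeakBases

/-! ### Prüfer modules over a Dedekind domain -/

section Prufer

variable {R : Type*} [CommRing R]

/-- Over a Dedekind domain, divisible modules satisfy Baer's criterion. -/
theorem Module.Baer.of_forall_smul_surjective [IsDedekindDomain R] {E : Type*} [AddCommGroup E]
    [Module R E] (hdiv : ∀ c : R, c ≠ 0 → ∀ e : E, ∃ e', c • e' = e) : Module.Baer R E := by
  intro I f
  by_cases hI : I = ⊥
  · subst hI
    refine ⟨0, fun x hx ↦ ?_⟩
    have : (⟨x, hx⟩ : (⊥ : Ideal R)) = 0 := Subsingleton.elim _ _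
    rw [this, map_zero, LinearMap.zero_apply]
  obtain ⟨c, hcI, hc⟩ := Submodule.exists_mem_ne_zero_of_ne_bot hI
  obtain ⟨J, hJ⟩ : I ∣ Ideal.span {c} :=
    Ideal.dvd_iff_le.2 ((Ideal.span_singleton_le_iff_mem I).2 hcI)
  -- For `c = ∑ aᵢ jᵢ` in `I * J` the extension is given by `e = ∑ jᵢ eᵢ`, where `c eᵢ = f aᵢ`. A
  -- general `z` allows induction on the sum; `z = c` forces `u = y`.
  have key : ∀ z ∈ I * J, ∃ e : E, ∀ y : I, ∃ u : I, c * u = y * z ∧ (y : R) • e = f u := by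
    intro z hz
    induction hz using Submodule.mul_induction_on' with
    | mem_mul_mem a ha j hj =>
      obtain ⟨e₀, he₀⟩ := hdiv c hc (f ⟨a, ha⟩)
      refine ⟨j • e₀, fun y ↦ ?_⟩
      obtain ⟨t, ht⟩ : c ∣ (y : R) * j := by
        rw [← Ideal.mem_span_singleton, hJ]
        exact Ideal.mul_mem_mul y.2 hj
      refine ⟨t • ⟨a, ha⟩, ?_, ?_⟩
      · change c * (t * a) = _
        linear_combination -a * ht
      · rw [map_smul, ← he₀, smul_smul, smul_smul, ht, mul_comm]
    | add z₁ _ z₂ _ h₁ h₂ =>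
      obtain ⟨e₁, h₁⟩ := h₁
      obtain ⟨e₂, h₂⟩ := h₂
      refine ⟨e₁ + e₂, fun y ↦ ?_⟩
      obtain ⟨u₁, h₁, h₁'⟩ := h₁ y
      obtain ⟨u₂, h₂, h₂'⟩ := h₂ y
      refine ⟨u₁ + u₂, ?_, ?_⟩
      · change c * ((u₁ : R) + u₂) = _
        linear_combination h₁ + h₂
      · rw [smul_add, h₁', h₂', map_add]
  obtain ⟨e, he⟩ := key c (hJ ▸ Ideal.mem_span_singleton_self c)
  refine ⟨LinearMap.toSpanSingleton R E e, fun x hx ↦ ?_⟩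
  obtain ⟨u, hu, hu'⟩ := he ⟨x, hx⟩
  have : u = ⟨x, hx⟩ := Subtype.ext (mul_left_cancel₀ hc (by rw [hu, mul_comm]))
  rw [LinearMap.toSpanSingleton_apply, hu', this]

/-- The localization of `R` at `p`, as a submodule of the fraction field. -/
def localSubmodule (p : Ideal R) [hp : p.IsPrime] : Submodule R (FractionRing R) where
  carrier := {x | ∃ s ∉ p, ∃ r : R, s • x = algebraMap R (FractionRing R) r}
  add_mem' := by
    rintro x y ⟨s, hs, r, hr⟩ ⟨t, ht, q, hq⟩
    refine ⟨s * t, fun h ↦ (hp.mem_or_mem h).elim hs ht, t * r + s * q, ?_⟩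
    rw [smul_add, mul_smul, mul_smul, smul_comm s t x, hr, hq, map_add, map_mul, map_mul,
      Algebra.smul_def, Algebra.smul_def]
  zero_mem' := ⟨1, p.one_notMem, 0, by simp⟩
  smul_mem' := by
    rintro c x ⟨s, hs, r, hr⟩
    exact ⟨s, hs, c * r, by rw [smul_comm, hr, map_mul, Algebra.smul_def]⟩

/-- The Prüfer module `R(p^∞)`. -/
abbrev Prufer (p : Ideal R) [p.IsPrime] : Type _ := FractionRing R ⧸ localSubmodule p

theorem Prufer.eq_zero_of_smul_eq_zero {p : Ideal R} [hp : p.IsPrime] {s : R} (hs : s ∉ p)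
    {e : Prufer p} (h : s • e = 0) : e = 0 := by
  obtain ⟨x, rfl⟩ := (localSubmodule p).mkQ_surjective e
  rw [← map_smul, Submodule.mkQ_apply, Submodule.Quotient.mk_eq_zero] at h
  obtain ⟨t, ht, r, hr⟩ := h
  rw [Submodule.mkQ_apply, Submodule.Quotient.mk_eq_zero]
  exact ⟨t * s, fun h ↦ (hp.mem_or_mem h).elim ht hs, r, by rw [mul_smul, hr]⟩

variable [IsDedekindDomain R]

/-- Locally at `p`, `(c)` is `p ^ n`: in `(c) = p ^ n J` with `p ∤ J`, any `s ∈ J \ p` clears the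
other primes. -/
theorem exists_pow_forall_dvd_mul (p : Ideal R) [hp : p.IsMaximal] (hp0 : p ≠ ⊥) {c : R}
    (hc : c ≠ 0) : ∃ n : ℕ, c ∈ p ^ n ∧ ∃ s ∉ p, ∀ b ∈ p ^ n, c ∣ s * b := by
  have hfin : FiniteMultiplicity p (Ideal.span {c}) :=
    FiniteMultiplicity.of_prime_left (Ideal.prime_of_isPrime hp0 hp.isPrime) (by simpa using hc)
  obtain ⟨J, hJ, hpJ⟩ := hfin.exists_eq_pow_mul_and_not_dvd
  obtain ⟨s, hsJ, hsp⟩ := SetLike.not_le_iff_exists.1 (mt Ideal.dvd_iff_le.2 hpJ)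
  have hle : Ideal.span {c} ≤ p ^ multiplicity p (Ideal.span {c}) :=
    hJ.le.trans Ideal.mul_le_left
  refine ⟨multiplicity p (Ideal.span {c}), hle (Ideal.mem_span_singleton_self c), s, hsp,
    fun b hb ↦ Ideal.mem_span_singleton.1 (hJ.ge ?_)⟩
  have := Ideal.mul_mem_mul hb hsJ
  rwa [mul_comm b s] at this

theorem exists_dvd_mul_or_dvd_mul (p : Ideal R) [hp : p.IsMaximal] (hp0 : p ≠ ⊥) {r c : R}
    (hr : r ≠ 0) (hc : c ≠ 0) : ∃ s ∉ p, c ∣ s * r ∨ r ∣ s * c := by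
  obtain ⟨m, hcm, s, hs, hcs⟩ := exists_pow_forall_dvd_mul p hp0 hc
  obtain ⟨n, hrn, t, ht, hrt⟩ := exists_pow_forall_dvd_mul p hp0 hr
  rcases le_total m n with h | h
  · exact ⟨s, hs, .inl (hcs r (Ideal.pow_le_pow_right h hrn))⟩
  · exact ⟨t, ht, .inr (hrt c (Ideal.pow_le_pow_right h hcm))⟩

namespace Prufer

variable {p : Ideal R}

theorem exists_smul_eq [p.IsPrime] {c : R} (hc : c ≠ 0) (e : Prufer p) : ∃ e', c • e' = e := by
  obtain ⟨x, rfl⟩ := (localSubmodule p).mkQ_surjective e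
  refine ⟨(localSubmodule p).mkQ ((algebraMap R (FractionRing R) c)⁻¹ * x), ?_⟩
  rw [← map_smul, Algebra.smul_def, mul_inv_cancel_left₀]
  simpa using hc

theorem baer [p.IsPrime] : Module.Baer R (Prufer p) :=
  Module.Baer.of_forall_smul_surjective fun _ hc ↦ exists_smul_eq hc

theorem exists_pow_smul_eq_zero [hp : p.IsMaximal] (hp0 : p ≠ ⊥) {a : R} (ha : a ∈ p)
    (e : Prufer p) : ∃ n, a ^ n • e = 0 := by
  obtain ⟨x, rfl⟩ := (localSubmodule p).mkQ_surjective e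
  obtain ⟨r, c, hc, rfl⟩ := IsFractionRing.div_surjective (A := R) x
  have hc0 := nonZeroDivisors.ne_zero hc
  obtain ⟨n, -, s, hs, hn⟩ := exists_pow_forall_dvd_mul p hp0 hc0
  obtain ⟨t, ht⟩ := hn _ (Ideal.pow_mem_pow ha n)
  refine ⟨n, ?_⟩
  rw [← map_smul, Submodule.mkQ_apply, Submodule.Quotient.mk_eq_zero]
  refine ⟨s, hs, t * r, ?_⟩
  have hc1 : algebraMap R (FractionRing R) c ≠ 0 := by simpa using hc0
  rw [smul_smul, ht, Algebra.smul_def, map_mul, map_mul]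
  field_simp

/-- Of two nonzero fractions one divides the other up to a factor outside `p`. An element of `L`
surviving a power of `a` that kills `e` cannot be a multiple of `e` in this sense, so `e` is one of
it. -/
theorem eq_top_of_forall_pow_smul_ne_zero [hp : p.IsMaximal] (hp0 : p ≠ ⊥) {a : R} (ha : a ∈ p)
    (L : Submodule R (Prufer p)) (hL : ∀ n, ∃ e ∈ L, a ^ n • e ≠ 0) : L = ⊤ := by
  refine top_unique fun e _ ↦ ?_
  -- it suffices to reach a multiple of `e` by an element prime to `p`
  suffices h : ∃ s ∉ p, s • e ∈ L by
    obtain ⟨s, hs, hse⟩ := h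
    obtain ⟨t, q, hq, htq⟩ : ∃ t, ∃ q ∈ p, t * s + q = 1 := by
      exact hp.exists_inv hs
    obtain ⟨n, hn⟩ := exists_pow_smul_eq_zero hp0 hq e
    obtain ⟨u, hu⟩ : t * s ∣ 1 - q ^ n := by
      have := sub_dvd_pow_sub_pow 1 q n
      rwa [one_pow, ← htq, add_sub_cancel_right, htq] at this
    have : e = (t * u) • s • e := by
      rw [smul_smul, show t * u * s = 1 - q ^ n by rw [hu]; ring, sub_smul, hn, one_smul, sub_zero]
    rw [this]
    exact L.smul_mem _ hse
  obtain ⟨n, hn⟩ := exists_pow_smul_eq_zero hp0 ha e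
  obtain ⟨f, hfL, hf⟩ := hL n
  obtain ⟨x, rfl⟩ := (localSubmodule p).mkQ_surjective e
  obtain ⟨y, rfl⟩ := (localSubmodule p).mkQ_surjective f
  by_cases hx : x = 0
  · exact ⟨1, p.one_notMem, by simp [hx]⟩
  have hy : y ≠ 0 := by rintro rfl; simp at hf
  obtain ⟨r₁, c₁, hc₁, rfl⟩ := IsFractionRing.div_surjective (A := R) x
  obtain ⟨r₂, c₂, hc₂, rfl⟩ := IsFractionRing.div_surjective (A := R) y
  have hc₁' : algebraMap R (FractionRing R) c₁ ≠ 0 := by simpa using nonZeroDivisors.ne_zero hc₁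
  have hc₂' : algebraMap R (FractionRing R) c₂ ≠ 0 := by simpa using nonZeroDivisors.ne_zero hc₂
  have hr₁ : r₁ ≠ 0 := by rintro rfl; simp at hx
  have hr₂ : r₂ ≠ 0 := by rintro rfl; simp at hy
  obtain ⟨s, hs, ⟨t, ht⟩ | ⟨t, ht⟩⟩ := exists_dvd_mul_or_dvd_mul p hp0
    (mul_ne_zero hr₁ (nonZeroDivisors.ne_zero hc₂)) (mul_ne_zero hr₂ (nonZeroDivisors.ne_zero hc₁))
  · refine ⟨s, hs, ?_⟩
    convert L.smul_mem t hfL using 1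
    rw [← map_smul, ← map_smul, Algebra.smul_def, Algebra.smul_def]
    congr 1
    have := congrArg (algebraMap R (FractionRing R)) ht
    simp only [map_mul] at this
    field_simp
    linear_combination this
  · refine absurd (eq_zero_of_smul_eq_zero hs (e := a ^ n •
      (localSubmodule p).mkQ (algebraMap R (FractionRing R) r₂ / algebraMap R _ c₂)) ?_) hf
    have : s • (localSubmodule p).mkQ (algebraMap R (FractionRing R) r₂ / algebraMap R _ c₂) =
        t • (localSubmodule p).mkQ (algebraMap R (FractionRing R) r₁ / algebraMap R _ c₁) := by
      rw [← map_smul, ← map_smul, Algebra.smul_def, Algebra.smul_def]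
      congr 1
      have := congrArg (algebraMap R (FractionRing R)) ht
      simp only [map_mul] at this
      field_simp
      linear_combination this
    rw [smul_comm, this, smul_comm, hn, smul_zero]

theorem exists_pow_smul_ne_zero [hp : p.IsPrime] {a : R} (ha : a ∈ p) (ha0 : a ≠ 0) (n : ℕ) :
    ∃ e : Prufer p, a ^ n • e ≠ 0 := by
  have h0 : algebraMap R (FractionRing R) a ≠ 0 := by simpa using ha0
  obtain ⟨e, he⟩ := exists_smul_eq (p := p) (pow_ne_zero n ha0)
    ((localSubmodule p).mkQ (algebraMap R (FractionRing R) a)⁻¹)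
  refine ⟨e, ?_⟩
  rw [he, Submodule.mkQ_apply, Ne, Submodule.Quotient.mk_eq_zero]
  rintro ⟨s, hs, r, hr⟩
  refine hs ?_
  have : s = r * a := by
    apply IsFractionRing.injective R (FractionRing R)
    rw [map_mul, ← hr, Algebra.smul_def, inv_mul_cancel_right₀ h0]
  exact this ▸ p.mul_mem_left r ha

/-- An associated prime is non-zero, as powers of `a` kill elements, and lies in `p`, as elements
outside `p` act injectively; being maximal, it is `p`. -/
theorem exists_ne_zero_forall_smul_eq_zero [hp : p.IsMaximal] (hp0 : p ≠ ⊥) :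
    ∃ e : Prufer p, e ≠ 0 ∧ ∀ b ∈ p, b • e = 0 := by
  obtain ⟨a, ha, ha0⟩ := Submodule.exists_mem_ne_zero_of_ne_bot hp0
  obtain ⟨e₀, he₀⟩ := exists_pow_smul_ne_zero ha ha0 0
  obtain ⟨q, hq, hle⟩ := exists_le_isAssociatedPrime_of_isNoetherianRing R (M := Prufer p) e₀
    (by simpa using he₀)
  obtain ⟨hqp, e, he⟩ := isAssociatedPrime_iff.1 hq
  have hmem : ∀ r, r ∈ q ↔ r • e = 0 := fun r ↦ by rw [he]; simp [Submodule.mem_colon_singleton]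
  have he0 : e ≠ 0 := fun h ↦ hqp.ne_top ((Ideal.eq_top_iff_one q).2 ((hmem 1).2 (by simp [h])))
  obtain ⟨n, hn⟩ := exists_pow_smul_eq_zero hp0 ha e
  have hq0 : q ≠ ⊥ := fun h ↦ pow_ne_zero n ha0 (by
    rw [← Ideal.mem_bot, ← h, hmem, hn])
  have hqle : q ≤ p := fun r hr ↦ by
    by_contra hrp
    exact he0 (eq_zero_of_smul_eq_zero hrp ((hmem r).1 hr))
  have hqm : q.IsMaximal := hqp.isMaximal hq0
  exact ⟨e, he0, fun b hb ↦ (hmem b).1 (hqm.eq_of_le hp.ne_top hqle ▸ hb)⟩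

theorem exists_extension [hp : p.IsPrime] {M : Type*} [AddCommGroup M] [Module R M]
    (N : Submodule R M) (f : N →ₗ[R] Prufer p) : ∃ g : M →ₗ[R] Prufer p, ∀ x : N, g x = f x := by
  obtain ⟨g, hg⟩ := Module.Baer.extension_property baer N.subtype N.injective_subtype f
  exact ⟨g, fun x ↦ congr($hg x)⟩

/-- The annihilator of `x` lies in `p`, so `x` can be sent to a non-zero element killed by `p`;
injectivity extends this map. -/
theorem exists_apply_ne_zero [hp : p.IsMaximal] (hp0 : p ≠ ⊥) {M : Type*} [AddCommGroup M]
    [Module R M] (x : M) (hx : ∀ s ∉ p, s • x ≠ 0) : ∃ g : M →ₗ[R] Prufer p, g x ≠ 0 := by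
  obtain ⟨e, he0, he⟩ := exists_ne_zero_forall_smul_eq_zero hp0
  have hle : Ideal.torsionOf R M x ≤ LinearMap.ker (LinearMap.toSpanSingleton R _ e) := fun r hr ↦ by
    rw [LinearMap.mem_ker, LinearMap.toSpanSingleton_apply]
    by_contra hr0
    exact hx r (fun hrp ↦ hr0 (he r hrp)) ((Ideal.mem_torsionOf_iff x r).1 hr)
  obtain ⟨g, hg⟩ := exists_extension (p := p) (Submodule.span R {x})
    (Submodule.liftQ _ (LinearMap.toSpanSingleton R _ e) hle ∘ₗ
      (Ideal.quotTorsionOfEquivSpanSingleton R M x).symm.toLinearMap)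
  refine ⟨g, ?_⟩
  have hsymm : (Ideal.quotTorsionOfEquivSpanSingleton R M x).symm
      ⟨x, Submodule.mem_span_singleton_self x⟩ = Submodule.Quotient.mk 1 := by
    rw [LinearEquiv.symm_apply_eq, Ideal.quotTorsionOfEquivSpanSingleton_apply_mk, one_smul]
  have := hg ⟨x, Submodule.mem_span_singleton_self x⟩
  rw [LinearMap.comp_apply, LinearEquiv.coe_coe, hsymm] at this
  change g x = (1 : R) • e at this
  rwa [this, one_smul]

end Prufer
end Prufer

/-! ### No surjection onto a Prüfer module -/

section Reduction

universe u v w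

variable {R : Type u} [CommRing R]

/-- A basis of `M / qM` lifts to a minimal generating set of `M` modulo `qM`, inside any submodule
`K` with `K + qM = M`. -/
theorem exists_minimal_span_sup_smul_top {M : Type*} [AddCommGroup M] [Module R M] (q : Ideal R)
    [hq : q.IsMaximal] (K : Submodule R M) (hK : K ⊔ q • ⊤ = ⊤) :
    ∃ V : Set M, V ⊆ K ∧ Submodule.span R V ⊔ q • ⊤ = ⊤ ∧
      ∀ V' ⊆ V, Submodule.span R V' ⊔ q • ⊤ = ⊤ → V' = V := by
  let _ := Ideal.Quotient.field q
  set Q : Submodule R M := q • ⊤ with hQ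
  let b := Module.Basis.ofVectorSpace (R ⧸ q) (M ⧸ (q • ⊤ : Submodule R M))
  have hlift : ∀ z : M ⧸ Q, ∃ y ∈ K, Q.mkQ y = z := by
    intro z
    obtain ⟨m, rfl⟩ := Q.mkQ_surjective z
    obtain ⟨n, hn, y, hy, rfl⟩ := Submodule.mem_sup.1 (hK ▸ Submodule.mem_top : m ∈ K ⊔ Q)
    exact ⟨n, hn, by simpa using hy⟩
  choose s hsK hs using hlift
  have hspan : ∀ V : Set M, Submodule.span R V ⊔ Q = ⊤ ↔
      Submodule.span (R ⧸ q) (Q.mkQ '' V) = ⊤ := by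
    intro V
    rw [← Submodule.restrictScalars_eq_top_iff (S := R) (R := R ⧸ q),
      Submodule.restrictScalars_span R (R ⧸ q) Ideal.Quotient.mk_surjective, ← Submodule.map_span]
    constructor
    · intro h
      rw [← Submodule.range_mkQ Q, ← Submodule.map_top, ← h, Submodule.map_sup,
        LinearMap.le_ker_iff_map.1 Q.ker_mkQ.ge, sup_bot_eq]
    · intro h
      have := congrArg (Submodule.comap Q.mkQ) h
      rwa [Submodule.comap_map_eq, Q.ker_mkQ, Submodule.comap_top] at this
  have himg : Q.mkQ '' (Set.range fun i ↦ s (b i)) = Set.range b := by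
    rw [← Set.range_comp]
    congr 1
    funext i
    exact hs _
  refine ⟨Set.range fun i ↦ s (b i), ?_, ?_, ?_⟩
  · rintro _ ⟨i, rfl⟩
    exact hsK _
  · rw [hspan, himg, b.span_eq]
  · intro V' hV' h
    refine hV'.antisymm ?_
    rintro _ ⟨i, rfl⟩
    by_contra hi
    rw [hspan] at h
    refine b.linearIndependent.notMem_span_image (s := {i}ᶜ) (x := i) (by simp) ?_
    refine Submodule.span_mono ?_ (h ▸ Submodule.mem_top : b i ∈ Submodule.span (R ⧸ q) _)
    rintro _ ⟨y, hy, rfl⟩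
    obtain ⟨j, rfl⟩ := hV' hy
    refine ⟨j, fun hji ↦ hi ?_, (hs _).symm⟩
    rw [Set.mem_singleton_iff] at hji
    exact hji ▸ hy

theorem IsRegularlyWeaklyBased.exists_quotient {M : Type v} [AddCommGroup M] [Module R M]
    (h : IsRegularlyWeaklyBased R M) (q : Ideal R) [hq : q.IsMaximal] (K : Submodule R M)
    (hK : K ⊔ q • ⊤ = ⊤) : ∃ N ≤ K, IsRegularlyWeaklyBased R (M ⧸ N) ∧ N ⊔ q • ⊤ = ⊤ := by
  obtain ⟨V, hVK, hV, hmin⟩ := exists_minimal_span_sup_smul_top q K hK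
  exact ⟨Submodule.span R V, Submodule.span_le.2 hVK,
    h.quotient_of_minimal _ _ V rfl hV hmin, hV⟩

variable [IsDedekindDomain R]

/-- For each prime factor `q` of `I`, divisibility of `E` gives `ker h + qM = M`, so a basis of M/qM
lifts into `ker h`. Factoring out its span achieves `qM = M`, keeps the surjection and preserves
earlier such equalities. -/
theorem IsRegularlyWeaklyBased.exists_surjective_smul_top_eq {E : Type w} [AddCommGroup E]
    [Module R E] (hdiv : ∀ c : R, c ≠ 0 → ∀ e : E, ∃ e', c • e' = e) (I : Ideal R) (hI : I ≠ ⊥)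
    {M : Type v} [AddCommGroup M] [Module R M] (hM : IsRegularlyWeaklyBased R M)
    (h : M →ₗ[R] E) (hh : Function.Surjective h) :
    ∃ (M' : Type v) (_ : AddCommGroup M') (_ : Module R M') (h' : M' →ₗ[R] E),
      IsRegularlyWeaklyBased R M' ∧ Function.Surjective h' ∧ I • (⊤ : Submodule R M') = ⊤ := by
  induction I using UniqueFactorizationMonoid.induction_on_prime with
  | h₁ => exact absurd rfl hI
  | h₂ I hu =>
    refine ⟨M, _, _, h, hM, hh, ?_⟩
    rw [Ideal.isUnit_iff.1 hu, Submodule.top_smul]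
  | h₃ I q hI0 hq ih =>
    obtain ⟨M', _, _, h', hM', hh', hIM⟩ := ih hI0
    have hqm : q.IsMaximal := (Ideal.isPrime_of_prime hq).isMaximal hq.ne_zero
    obtain ⟨c, hcq, hc⟩ := Submodule.exists_mem_ne_zero_of_ne_bot hq.ne_zero
    obtain ⟨N, hN, hRWB, hNq⟩ := hM'.exists_quotient q (LinearMap.ker h') (by
      refine top_unique fun y _ ↦ ?_
      obtain ⟨e, he⟩ := hdiv c hc (h' y)
      obtain ⟨z, rfl⟩ := hh' e
      rw [← sub_add_cancel y (c • z)]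
      refine Submodule.add_mem_sup ?_ (Submodule.smul_mem_smul hcq trivial)
      rw [LinearMap.mem_ker, map_sub, map_smul, he, sub_self])
    have htop : ∀ J : Ideal R, J • (⊤ : Submodule R (M' ⧸ N)) = Submodule.map N.mkQ (J • ⊤) := by
      intro J
      rw [Submodule.map_smul'', Submodule.map_top, Submodule.range_mkQ]
    have hI' : I • (⊤ : Submodule R (M' ⧸ N)) = ⊤ := by
      rw [htop, hIM, Submodule.map_top, Submodule.range_mkQ]
    have hq' : q • (⊤ : Submodule R (M' ⧸ N)) = ⊤ := by
      have := congrArg (Submodule.map N.mkQ) hNq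
      rwa [Submodule.map_sup, LinearMap.le_ker_iff_map.1 N.ker_mkQ.ge, bot_sup_eq,
        Submodule.map_top, Submodule.range_mkQ, ← htop] at this
    refine ⟨M' ⧸ N, _, _, N.liftQ h' hN, hRWB, ?_, ?_⟩
    · intro e
      obtain ⟨y, rfl⟩ := hh' e
      exact ⟨N.mkQ y, N.liftQ_apply h' y⟩
    · rw [Submodule.mul_smul, hI', hq']

/-- After reduction to `aM' = M'`, divide repeatedly by `a`, starting from an `x₀` with non-zero
image. The images together are unbounded, hence generate, but each one alone is killed by a power of
`a`. -/
theorem IsRegularlyWeaklyBased.not_surjective_prufer {M : Type v} [AddCommGroup M] [Module R M]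
    (hM : IsRegularlyWeaklyBased R M) {p : Ideal R} [hp : p.IsMaximal] (hp0 : p ≠ ⊥)
    (h : M →ₗ[R] Prufer p) : ¬ Function.Surjective h := by
  intro hh
  obtain ⟨a, ha, ha0⟩ := Submodule.exists_mem_ne_zero_of_ne_bot hp0
  obtain ⟨M', _, _, h', hM', hh', htop⟩ := hM.exists_surjective_smul_top_eq
    (fun c hc e ↦ Prufer.exists_smul_eq hc e) (Ideal.span {a}) (by simpa using ha0) h hh
  have hdiv : ∀ y : M', ∃ z, a • z = y := by
    intro y
    have : y ∈ Ideal.span {a} • (⊤ : Submodule R M') := by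
      rw [htop]; trivial
    rw [Submodule.ideal_span_singleton_smul] at this
    obtain ⟨z, -, hz⟩ := this
    exact ⟨z, hz⟩
  choose d hd using hdiv
  obtain ⟨e, he⟩ := Prufer.exists_pow_smul_ne_zero ha ha0 0
  obtain ⟨x₀, rfl⟩ := hh' e
  rw [pow_zero, one_smul] at he
  let x : ℕ → M' := fun n ↦ d^[n] x₀
  have hx : ∀ n, a • x (n + 1) = x n := fun n ↦ by
    simp only [x, Function.iterate_succ_apply', hd]
  have hpow : ∀ n, a ^ n • x n = x₀ := by
    intro n
    induction n with
    | zero => simp [x]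
    | succ n ih => rw [pow_succ, mul_smul, hx, ih]
  have hmap : ∀ (L : Submodule R M'), LinearMap.ker h' ⊔ L = ⊤ ↔ Submodule.map h' L = ⊤ := by
    intro L
    constructor
    · intro h
      have := congrArg (Submodule.map h') h
      rwa [Submodule.map_sup, LinearMap.le_ker_iff_map.1 le_rfl, bot_sup_eq, Submodule.map_top,
        LinearMap.range_eq_top.2 hh'] at this
    · intro h
      rw [sup_comm, ← Submodule.comap_map_eq, h, Submodule.comap_top]
  refine not_isRegularlyWeaklyBased_of_chain (LinearMap.ker h') x (fun n ↦ ?_) ?_ (fun n ↦ ?_) hM'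
  · rw [← hx n]
    exact Submodule.smul_mem _ _ (Submodule.mem_span_singleton_self _)
  · rw [hmap]
    refine Prufer.eq_top_of_forall_pow_smul_ne_zero hp0 ha _ fun n ↦
      ⟨h' (x n), Submodule.mem_map_of_mem (Submodule.subset_span ⟨n, rfl⟩), ?_⟩
    rwa [← map_smul, hpow]
  · rw [Ne, hmap, Submodule.map_span, Set.image_singleton]
    intro hspan
    obtain ⟨m, hm⟩ := Prufer.exists_pow_smul_eq_zero hp0 ha (h' (x n))
    obtain ⟨e, he⟩ := Prufer.exists_pow_smul_ne_zero (p := p) ha ha0 m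
    obtain ⟨r, rfl⟩ := Submodule.mem_span_singleton.1
      (hspan ▸ Submodule.mem_top : e ∈ Submodule.span R {h' (x n)})
    rw [smul_comm, hm, smul_zero] at he
    exact he rfl

end Reduction

/-! ### Regularly weakly based torsion modules are bounded -/

section Torsion

variable {R M : Type*} [CommRing R] [IsDedekindDomain R] [AddCommGroup M] [Module R M]

/-- A map to the Prüfer module is not onto, so some `a ^ n` kills its image. Locally `(a ^ n)` is `p
^ N`, and `M = p ^ N M`, so the map is zero. -/
theorem exists_notMem_smul_eq_zero_of_smul_top_eq (hM : IsRegularlyWeaklyBased R M) {p : Ideal R}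
    [hp : p.IsMaximal] (hp0 : p ≠ ⊥) (htop : p • (⊤ : Submodule R M) = ⊤) (x : M) :
    ∃ s ∉ p, s • x = 0 := by
  by_contra! hx
  obtain ⟨f, hf⟩ := Prufer.exists_apply_ne_zero hp0 x hx
  obtain ⟨a, ha, ha0⟩ := Submodule.exists_mem_ne_zero_of_ne_bot hp0
  refine hM.not_surjective_prufer hp0 f (LinearMap.range_eq_top.1
    (Prufer.eq_top_of_forall_pow_smul_ne_zero hp0 ha _ fun n ↦ ?_))
  by_contra! hn
  obtain ⟨N, -, s, hs, hdvd⟩ := exists_pow_forall_dvd_mul p hp0 (pow_ne_zero n ha0)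
  have hN : ∀ N : ℕ, p ^ N • (⊤ : Submodule R M) = ⊤ := by
    intro N
    induction N with
    | zero => rw [pow_zero, Ideal.one_eq_top, Submodule.top_smul]
    | succ N ih => rw [pow_succ, Submodule.mul_smul, htop, ih]
  have hsf : ∀ y ∈ p ^ N • (⊤ : Submodule R M), s • f y = 0 := by
    intro y hy
    induction hy using Submodule.smul_induction_on' with
    | smul b hb z _ =>
      obtain ⟨t, ht⟩ := hdvd b hb
      rw [map_smul, smul_smul, ht, mul_comm, mul_smul, hn _ ⟨z, rfl⟩, smul_zero]
    | add y _ z _ hy hz => rw [map_add, smul_add, hy, hz, add_zero]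
  exact hf (Prufer.eq_zero_of_smul_eq_zero hs (hsf x ((hN N).ge Submodule.mem_top)))

/-- Otherwise maps to the Prüfer module of growing exponent glue to an unbounded, hence surjective,
one: each stage fixes the map on a stratum `T k`, and the strata exhaust `M`. -/
theorem exists_forall_notMem_smul_eq_zero (ht : ∀ x : M, ∃ c : R, c ≠ 0 ∧ c • x = 0)
    (hM : IsRegularlyWeaklyBased R M) {p : Ideal R}
    [hp : p.IsMaximal] (hp0 : p ≠ ⊥) :
    ∃ c : R, c ≠ 0 ∧ ∀ x : M, ∃ s ∉ p, s • c • x = 0 := by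
  obtain ⟨a, ha, ha0⟩ := Submodule.exists_mem_ne_zero_of_ne_bot hp0
  by_contra! hc
  let T : ℕ → M → Prop := fun k x ↦ ∃ s ∉ p, s • a ^ k • x = 0
  have hT : ∀ x, ∃ k, T k x := by
    intro x
    obtain ⟨c, hc0, hcx⟩ := ht x
    obtain ⟨k, -, s, hs, hk⟩ := exists_pow_forall_dvd_mul p hp0 hc0
    obtain ⟨t, ht⟩ := hk _ (Ideal.pow_mem_pow ha k)
    exact ⟨k, s, hs, by rw [smul_smul, ht, mul_comm, mul_smul, hcx, smul_zero]⟩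
  have hTmono : ∀ k l x, k ≤ l → T k x → T l x := by
    rintro k l x hkl ⟨s, hs, h⟩
    obtain ⟨m, rfl⟩ := Nat.exists_eq_add_of_le' hkl
    exact ⟨s, hs, by rw [pow_add, mul_smul, smul_comm, h, smul_zero]⟩
  have hTf : ∀ k x, T k x → ∀ f : M →ₗ[R] Prufer p, a ^ k • f x = 0 := by
    rintro k x ⟨s, hs, h⟩ f
    refine Prufer.eq_zero_of_smul_eq_zero hs ?_
    rw [← map_smul, ← map_smul, h, map_zero]
  have hbig : ∀ n, ∃ (f : M →ₗ[R] Prufer p) (x : M), a ^ n • f x ≠ 0 := by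
    intro n
    obtain ⟨x, hx⟩ := hc (a ^ n) (pow_ne_zero n ha0)
    obtain ⟨f, hf⟩ := Prufer.exists_apply_ne_zero hp0 _ hx
    exact ⟨f, x, by rwa [map_smul] at hf⟩
  have hstep : ∀ (n : ℕ) (S : (M →ₗ[R] Prufer p) × ℕ), ∃ S' : (M →ₗ[R] Prufer p) × ℕ,
      (∀ x, T S.2 x → S'.1 x = S.1 x) ∧ (∃ w, T S'.2 w ∧ a ^ n • S'.1 w ≠ 0) ∧ S.2 < S'.2 := by
    rintro n ⟨f, k⟩
    suffices h : ∃ g : M →ₗ[R] Prufer p, (∀ x, T k x → g x = f x) ∧ ∃ w, a ^ n • g w ≠ 0 by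
      obtain ⟨g, hg, w, hw⟩ := h
      obtain ⟨l, hl⟩ := hT w
      exact ⟨(g, k + 1 + l), hg, ⟨w, hTmono _ _ _ (Nat.le_add_left _ _) hl, hw⟩, by
        change k < k + 1 + l; omega⟩
    by_cases hf : ∃ w, a ^ n • f w ≠ 0
    · exact ⟨f, fun _ _ ↦ rfl, hf⟩
    · push Not at hf
      -- The correction `a ^ k • g` vanishes on `T k`; the extra `k` in the exponent compensates for
      -- that factor.
      obtain ⟨g, w, hw⟩ := hbig (n + k)
      refine ⟨f + a ^ k • g, fun x hx ↦ ?_, w, ?_⟩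
      · rw [LinearMap.add_apply, LinearMap.smul_apply, hTf k x hx, add_zero]
      · rwa [LinearMap.add_apply, smul_add, hf, zero_add, LinearMap.smul_apply, smul_smul,
          ← pow_add]
  choose step hstep₁ hstep₂ hstep₃ using hstep
  let S : ℕ → (M →ₗ[R] Prufer p) × ℕ := fun n ↦ Nat.rec (0, 0) step n
  have hS : ∀ n, S (n + 1) = step n (S n) := fun _ ↦ rfl
  have hk : ∀ n, n ≤ (S n).2 := by
    intro n
    induction n with
    | zero => exact Nat.zero_le _
    | succ n ih => exact Nat.succ_le_of_lt (ih.trans_lt (hS n ▸ hstep₃ n (S n)))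
  have hmono : Monotone fun n ↦ (S n).2 :=
    monotone_nat_of_le_succ fun n ↦ (hS n ▸ hstep₃ n (S n)).le
  have hstab : ∀ n m x, n ≤ m → T (S n).2 x → (S m).1 x = (S n).1 x := by
    intro n m x hnm hx
    induction hnm with
    | refl => rfl
    | step hle ih => rw [Nat.succ_eq_add_one, hS, hstep₁ _ _ _ (hTmono _ _ _ (hmono hle) hx), ih]
  choose κ hκ using hT
  have hlim : ∀ x m, κ x ≤ m → (S m).1 x = (S (κ x)).1 x := fun x m hm ↦
    hstab _ _ _ hm (hTmono _ _ _ (hk _) (hκ x))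
  let h : M →ₗ[R] Prufer p :=
    { toFun := fun x ↦ (S (κ x)).1 x
      map_add' := fun x y ↦ by
        let m := max (κ x) (max (κ y) (κ (x + y)))
        rw [← hlim x m (by simp [m]), ← hlim y m (by simp [m]), ← hlim (x + y) m (by simp [m]),
          map_add]
      map_smul' := fun c x ↦ by
        let m := max (κ x) (κ (c • x))
        rw [← hlim x m (by simp [m]), ← hlim (c • x) m (by simp [m]), map_smul, RingHom.id_apply] }
  refine hM.not_surjective_prufer hp0 h (LinearMap.range_eq_top.1
    (Prufer.eq_top_of_forall_pow_smul_ne_zero hp0 ha _ fun n ↦ ?_))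
  obtain ⟨w, hTw, hw⟩ := hstep₂ n (S n)
  rw [← hS] at hTw hw
  refine ⟨h w, ⟨w, rfl⟩, ?_⟩
  have : h w = (S (n + 1)).1 w := by
    rw [← hstab (n + 1) (max (n + 1) (κ w)) w (le_max_left _ _) hTw,
      hlim w _ (le_max_right _ _)]
    rfl
  rwa [this]

-- Infinitely many such primes would map `M` onto a direct sum of the R/P n. The chain consists of
-- the partial sums of the `y i`, each `y i` being recovered by the Chinese remainder theorem.
open IsDedekindDomain in
theorem finite_setOf_forall_notMem_smul_ne_zero (ht : ∀ x : M, ∃ c : R, c ≠ 0 ∧ c • x = 0)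
    (hM : IsRegularlyWeaklyBased R M) :
    {v : HeightOneSpectrum R | ∃ x : M, ∀ s ∉ v.asIdeal, s • x ≠ 0}.Finite := by
  classical
  by_contra hinf
  let φ := Set.Infinite.natEmbedding _ hinf
  let P : ℕ → Ideal R := fun n ↦ (φ n).1.asIdeal
  have hP0 : ∀ n, P n ≠ ⊥ := fun n ↦ (φ n).1.ne_bot
  have hPm : ∀ n, (P n).IsMaximal := fun n ↦ (φ n).1.isMaximal
  have hPinj : Function.Injective P := fun m n h ↦
    φ.injective (Subtype.ext (HeightOneSpectrum.ext h))
  have hPne : ∀ n, P n • (⊤ : Submodule R M) ≠ ⊤ := by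
    intro n h
    obtain ⟨x, hx⟩ := (φ n).2
    obtain ⟨s, hs, hsx⟩ := exists_notMem_smul_eq_zero_of_smul_top_eq hM (hP0 n) h x
    exact hx s hs hsx
  have hy : ∀ n, ∃ y ∉ P n • (⊤ : Submodule R M), ∃ k : ℕ, ∀ b ∈ P n ^ k, b • y = 0 := by
    intro n
    obtain ⟨y, -, hy⟩ := SetLike.exists_of_lt (lt_top_iff_ne_top.2 (hPne n))
    obtain ⟨c, hc, hcy⟩ := ht y
    obtain ⟨k, -, s, hs, hk⟩ := exists_pow_forall_dvd_mul (P n) (hP0 n) hc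
    -- Multiplying by `s` removes the torsion of `y` away from `P n`; as `s` is a unit modulo `P n`,
    -- the result stays outside `P n • ⊤`.
    refine ⟨s • y, fun hsy ↦ hy ?_, k, fun b hb ↦ ?_⟩
    · obtain ⟨t, q, hq, htq⟩ := (hPm n).exists_inv hs
      rw [← one_smul R y, ← htq, add_smul, mul_smul]
      exact add_mem (Submodule.smul_mem _ _ hsy) (Submodule.smul_mem_smul hq trivial)
    · obtain ⟨t, ht⟩ := hk b hb
      rw [smul_smul, mul_comm, ht, mul_comm, mul_smul, hcy, smul_zero]
  choose y hyP k hk using hy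
  have hf : ∀ n, ∃ f : M →ₗ[R] R ⧸ P n, f (y n) ≠ 0 := by
    intro n
    let _ := Ideal.Quotient.field (P n)
    by_contra! hf
    refine hyP n ?_
    rw [← Submodule.Quotient.mk_eq_zero, ← Module.forall_dual_apply_eq_zero_iff (R ⧸ P n)]
    intro ψ
    exact hf (ψ.restrictScalars R ∘ₗ Submodule.mkQ _)
  choose f hf using hf
  have hreg : ∀ n, ∀ s ∉ P n, ∀ e : R ⧸ P n, s • e = 0 → e = 0 := by
    intro n s hs e he
    have := Ideal.Quotient.isDomain (P n)
    rw [Algebra.smul_def, mul_eq_zero] at he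
    exact he.resolve_left fun h ↦ hs (Ideal.Quotient.eq_zero_iff_mem.1 h)
  have hfy : ∀ m n, m ≠ n → f n (y m) = 0 := by
    intro m n hmn
    have : ¬ P m ^ k m ≤ P n := fun h ↦
      hmn (hPinj ((hPm m).eq_of_le (hPm n).ne_top ((hPm n).isPrime.le_of_pow_le h)))
    obtain ⟨b, hb, hbn⟩ := SetLike.not_le_iff_exists.1 this
    refine hreg n b hbn _ ?_
    rw [← map_smul, hk m b hb, map_zero]
  have hfin : ∀ x, ∃ n₀, ∀ n, n₀ ≤ n → f n x = 0 := by
    intro x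
    obtain ⟨c, hc, hcx⟩ := ht x
    have h1 : {n : ℕ | c ∈ P n}.Finite := by
      have := Ideal.finite_factors (I := Ideal.span {c}) (by simpa using hc)
      refine (this.preimage (f := fun n ↦ (φ n).1) ?_).subset ?_
      · exact (Subtype.val_injective.comp φ.injective).injOn
      · intro n hn
        exact Ideal.dvd_span_singleton.2 hn
    obtain ⟨n₀, hn₀⟩ := h1.bddAbove
    refine ⟨n₀ + 1, fun n hn ↦ hreg n c (fun hcn ↦ ?_) _ ?_⟩
    · have := hn₀ hcn
      omega
    · rw [← map_smul, hcx, map_zero]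
  let x : ℕ → M := fun n ↦ ∑ i ∈ Finset.range (n + 1), y i
  have hyx : ∀ n, ∀ i ∈ Finset.range (n + 1), y i ∈ Submodule.span R {x n} := by
    intro n i hi
    obtain ⟨r, hr⟩ := exists_forall_sub_mem_ideal (s := Finset.range (n + 1)) P k
      (fun j _ ↦ Ideal.prime_of_isPrime (hP0 j) (hPm j).isPrime)
      (fun j _ l _ hjl h ↦ hjl (hPinj h)) (fun j ↦ if j.1 = i then 1 else 0)
    refine Submodule.mem_span_singleton.2 ⟨r, ?_⟩
    rw [Finset.smul_sum, Finset.sum_eq_single_of_mem i hi]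
    · have := hk i _ (hr i hi)
      rwa [if_pos rfl, sub_smul, one_smul, sub_eq_zero] at this
    · intro j hj hji
      have := hk j _ (hr j hj)
      rwa [if_neg hji, sub_zero] at this
  refine not_isRegularlyWeaklyBased_of_chain (⨅ n, LinearMap.ker (f n)) x (fun n ↦ ?_) ?_
    (fun n htop ↦ ?_) hM
  · refine Submodule.sum_mem _ fun i hi ↦ hyx (n + 1) i ?_
    rw [Finset.mem_range] at hi ⊢
    omega
  · refine top_unique fun z _ ↦ ?_
    obtain ⟨n₀, hn₀⟩ := hfin z
    have hr : ∀ i, ∃ r : R, r • f i (y i) = f i z := by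
      intro i
      let _ := Ideal.Quotient.field (P i)
      obtain ⟨r, hr⟩ := Ideal.Quotient.mk_surjective (f i z / f i (y i))
      refine ⟨r, ?_⟩
      rw [Algebra.smul_def, Ideal.Quotient.algebraMap_eq, hr, div_mul_cancel₀ _ (hf i)]
    choose r hr using hr
    rw [← sub_add_cancel z (∑ i ∈ Finset.range n₀, r i • y i)]
    refine Submodule.add_mem_sup ((Submodule.mem_iInf _).2 fun n ↦ ?_) ?_
    · rw [LinearMap.mem_ker, map_sub, map_sum, sub_eq_zero]
      by_cases hn : n ∈ Finset.range n₀
      · rw [Finset.sum_eq_single_of_mem n hn, map_smul, hr]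
        intro j _ hjn
        rw [map_smul, hfy j n hjn, smul_zero]
      · rw [hn₀ n (by simpa using hn), Finset.sum_eq_zero]
        intro j hj
        rw [map_smul, hfy j n (fun h ↦ hn (h ▸ hj)), smul_zero]
    · refine Submodule.sum_mem _ fun i _ ↦ Submodule.smul_mem _ _ ?_
      refine Submodule.span_mono ?_ (hyx i i (by simp))
      exact Set.singleton_subset_iff.2 ⟨i, rfl⟩
  · have hle : (⨅ n, LinearMap.ker (f n)) ⊔ Submodule.span R {x n} ≤
        LinearMap.ker (f (n + 1)) := by
      refine sup_le (iInf_le _ _) ((Submodule.span_singleton_le_iff_mem _ _).2 ?_)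
      rw [LinearMap.mem_ker, map_sum]
      refine Finset.sum_eq_zero fun i hi ↦ hfy i (n + 1) ?_
      rw [Finset.mem_range] at hi
      omega
    rw [htop] at hle
    exact hf (n + 1) (LinearMap.mem_ker.1 (hle trivial))

open IsDedekindDomain in
theorem IsRegularlyWeaklyBased.exists_smul_eq_zero_of_torsion
    (hM : IsRegularlyWeaklyBased R M) (ht : ∀ x : M, ∃ c : R, c ≠ 0 ∧ c • x = 0) :
    ∃ b : R, b ≠ 0 ∧ ∀ x : M, b • x = 0 := by
  have hfin := finite_setOf_forall_notMem_smul_ne_zero ht hM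
  have hc : ∀ v : HeightOneSpectrum R, ∃ c : R, c ≠ 0 ∧ ∀ x : M, ∃ s ∉ v.asIdeal, s • c • x = 0 :=
    fun v ↦
      have := v.isMaximal
      exists_forall_notMem_smul_eq_zero ht hM v.ne_bot
  choose c hc0 hc using hc
  refine ⟨∏ v ∈ hfin.toFinset, c v, Finset.prod_ne_zero_iff.2 fun v _ ↦ hc0 v, fun x ↦ ?_⟩
  set b := ∏ v ∈ hfin.toFinset, c v with hb
  rw [← Ideal.torsionOf_eq_top_iff R]
  by_contra hne
  obtain ⟨q, hq, hle⟩ := Ideal.exists_le_maximal _ hne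
  have hq0 : q ≠ ⊥ := by
    rintro rfl
    obtain ⟨d, hd, hdx⟩ := ht (b • x)
    exact hd (Ideal.mem_bot.1 (hle ((Ideal.mem_torsionOf_iff _ d).2 hdx)))
  let v : HeightOneSpectrum R := ⟨q, hq.isPrime, hq0⟩
  suffices h : ∃ s ∉ q, s • b • x = 0 by
    obtain ⟨s, hs, hsx⟩ := h
    exact hs (hle ((Ideal.mem_torsionOf_iff _ s).2 hsx))
  by_cases hv : v ∈ hfin.toFinset
  · obtain ⟨d, hd⟩ := Finset.dvd_prod_of_mem c hv
    obtain ⟨s, hs, hsx⟩ := hc v (d • x)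
    exact ⟨s, hs, by rwa [hb, hd, mul_smul]⟩
  · rw [Set.Finite.mem_toFinset, Set.mem_ofPred_eq] at hv
    push Not at hv
    exact hv _

end Torsion
-- Finite rank, projectivity modulo torsion, and splitting
section Decomposition

variable {R M : Type*} [CommRing R] [IsDedekindDomain R] [AddCommGroup M] [Module R M]

/-- Independent elements can be sent to Prüfer elements of unbounded exponent, and an extension to
`M` would be onto. -/
theorem IsRegularlyWeaklyBased.not_linearIndependent_nat (hM : IsRegularlyWeaklyBased R M)
    {p : Ideal R} [hp : p.IsMaximal] (hp0 : p ≠ ⊥) (x : ℕ → M) : ¬ LinearIndependent R x := by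
  intro hx
  obtain ⟨a, ha, ha0⟩ := Submodule.exists_mem_ne_zero_of_ne_bot hp0
  choose e he using Prufer.exists_pow_smul_ne_zero (p := p) ha ha0
  obtain ⟨g, hg⟩ := Prufer.exists_extension (Submodule.span R (Set.range x))
    ((Module.Basis.span hx).constr R e)
  have hgx : ∀ n, g (x n) = e n := by
    intro n
    have := hg (Module.Basis.span hx n)
    rwa [Module.Basis.constr_basis, Module.Basis.span_apply] at this
  refine hM.not_surjective_prufer hp0 g (LinearMap.range_eq_top.1
    (Prufer.eq_top_of_forall_pow_smul_ne_zero hp0 ha _ fun n ↦ ⟨e n, ⟨x n, hgx n⟩, he n⟩))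

theorem IsRegularlyWeaklyBased.exists_free_torsion_quotient (hM : IsRegularlyWeaklyBased R M)
    {p : Ideal R} [hp : p.IsMaximal] (hp0 : p ≠ ⊥) :
    ∃ G : Submodule R M, G.FG ∧ Module.IsTorsionFree R G ∧
      ∀ x : M, ∃ c : R, c ≠ 0 ∧ c • x ∈ G := by
  obtain ⟨s, hs, hmax⟩ := exists_maximal_linearIndepOn R (id : M → M)
  have hfin : s.Finite := by
    by_contra hinf
    exact hM.not_linearIndependent_nat hp0 _
      (hs.linearIndependent.comp _ (Set.Infinite.natEmbedding s hinf).injective)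
  refine ⟨Submodule.span R (Set.range fun i : s ↦ id (i : M)), ?_, ?_, fun x ↦ ?_⟩
  · have := hfin.to_subtype
    exact Submodule.fg_span (Set.finite_range _)
  · have := Module.Free.of_basis (Module.Basis.span hs.linearIndependent)
    infer_instance
  · by_cases hx : x ∈ s
    · exact ⟨1, one_ne_zero, by
        rw [one_smul]; exact Submodule.subset_span ⟨⟨x, hx⟩, rfl⟩⟩
    · obtain ⟨c, hc, hcx⟩ := hmax x hx
      rw [Set.image_eq_range] at hcx
      exact ⟨c, hc, hcx⟩

/-- A regularly weakly based module has bounded torsion, and is projective modulo torsion. -/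
theorem IsRegularlyWeaklyBased.projective_and_bounded (hM : IsRegularlyWeaklyBased R M) :
    Module.Projective R (M ⧸ Submodule.torsion R M) ∧
      ∃ b : R, b ≠ 0 ∧ ∀ x ∈ Submodule.torsion R M, b • x = 0 := by
  -- A field has no non-zero prime, so the Prüfer argument is unavailable and the rank may be
  -- infinite.
  by_cases hF : IsField R
  · refine ⟨?_, 1, one_ne_zero, ?_⟩
    · let _ := hF.toField
      have : Module.Free R (M ⧸ Submodule.torsion R M) := Module.Free.of_divisionRing R _
      exact Module.Projective.of_free
    · rintro x ⟨⟨c, hc⟩, hcx⟩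
      obtain ⟨d, hd⟩ := hF.mul_inv_cancel (nonZeroDivisors.ne_zero hc)
      change c • x = 0 at hcx
      rw [← hd, mul_comm, mul_smul, hcx, smul_zero]
  obtain ⟨p, hp0, hp⟩ := Ring.not_isField_iff_exists_prime.1 hF
  have := hp.isMaximal hp0
  obtain ⟨G, hG, hGtf, hGt⟩ := hM.exists_free_torsion_quotient hp0
  obtain ⟨b, hb, hbM⟩ := (hM.quotient_of_fg G hG).exists_smul_eq_zero_of_torsion (by
    intro y
    obtain ⟨x, rfl⟩ := G.mkQ_surjective y
    obtain ⟨c, hc, hcx⟩ := hGt x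
    exact ⟨c, hc, by
      rwa [← map_smul, ← LinearMap.mem_ker, G.ker_mkQ]⟩)
  have hbG : ∀ x : M, b • x ∈ G := by
    intro x
    have := hbM (G.mkQ x)
    rwa [← map_smul, ← LinearMap.mem_ker, G.ker_mkQ] at this
  have hbT : ∀ x ∈ Submodule.torsion R M, b • x = 0 := by
    rintro x ⟨⟨c, hc⟩, hcx⟩
    change c • x = 0 at hcx
    have : c • (⟨b • x, hbG x⟩ : G) = 0 := by
      apply Subtype.ext
      change c • b • x = 0
      rw [smul_comm, hcx, smul_zero]
    have := (smul_eq_zero.1 this).resolve_left (nonZeroDivisors.ne_zero hc)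
    exact congrArg Subtype.val this
  refine ⟨?_, b, hb, hbT⟩
  -- Multiplication by `b` embeds `M` modulo torsion in `G`, so that quotient is finitely generated
  -- and torsion-free, hence projective.
  let f : M →ₗ[R] G := (LinearMap.lsmul R M b).codRestrict G hbG
  have hf : ∀ x, (f x : M) = b • x := fun _ ↦ rfl
  have hker : LinearMap.ker f = Submodule.torsion R M := by
    ext x
    rw [LinearMap.mem_ker, ← Submodule.coe_eq_zero, hf]
    exact ⟨fun h ↦ ⟨⟨b, mem_nonZeroDivisors_of_ne_zero hb⟩, h⟩, hbT x⟩
  have hinj : Function.Injective ((Submodule.torsion R M).liftQ f hker.ge) := by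
    rw [← LinearMap.ker_eq_bot, Submodule.ker_liftQ_eq_bot' _ _ hker.symm]
  have : Module.Finite R G := Module.Finite.iff_fg.2 hG
  have : Module.Finite R (M ⧸ Submodule.torsion R M) := Module.Finite.of_injective _ hinj
  have : Module.FinitePresentation R (M ⧸ Submodule.torsion R M) :=
    Module.finitePresentation_of_finite R _
  exact Module.Flat.projective_of_finitePresentation

theorem Submodule.exists_isCompl_of_projective_quotient {R M : Type*} [Ring R] [AddCommGroup M]
    [Module R M] (T : Submodule R M) [Module.Projective R (M ⧸ T)] :
    ∃ P : Submodule R M, IsCompl P T := by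
  obtain ⟨s, hs⟩ := T.mkQ.exists_rightInverse_of_surjective T.range_mkQ
  have hs' : ∀ y, T.mkQ (s y) = y := fun y ↦ congr($hs y)
  refine ⟨LinearMap.range s, ?_, ?_⟩
  · rw [Submodule.disjoint_def]
    rintro _ ⟨y, rfl⟩ hy
    have : T.mkQ (s y) = 0 := by simpa using hy
    rw [← hs' y, this, map_zero]
  · rw [codisjoint_iff]
    refine top_unique fun x _ ↦ ?_
    rw [← add_sub_cancel (s (T.mkQ x)) x]
    refine Submodule.add_mem_sup ⟨_, rfl⟩ ?_
    exact T.ker_mkQ.le (by rw [LinearMap.mem_ker, map_sub, hs', sub_self])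

end Decomposition

theorem lemma4p4 (R M : Type*) [CommRing R] [IsDedekindDomain R] [AddCommGroup M] [Module R M] :
    (IsRegularlyWeaklyBased R M →
      ∃ P B : Submodule R M, IsCompl P B ∧ Module.Projective R P ∧
        Module.IsTorsion R B ∧ IsBoundedModule R B) ∧
    (¬ Module.Projective R (M ⧸ Submodule.torsion R M) →
      ∃ X : Set M, Submodule.span R X = ⊤ ∧ ∀ W : Set M, W ⊆ X → ¬ IsWeakBasis R W) := by
  refine ⟨fun hM ↦ ?_, fun hproj ↦ ?_⟩
  · obtain ⟨hproj, b, hb, hbT⟩ := hM.projective_and_bounded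
    obtain ⟨P, hP⟩ := (Submodule.torsion R M).exists_isCompl_of_projective_quotient
    refine ⟨P, Submodule.torsion R M, hP,
      Module.Projective.of_equiv (Submodule.quotientEquivOfIsCompl _ P hP.symm),
      Submodule.torsion_isTorsion, Ideal.span {b}, by simpa using hb, fun a ha m ↦ ?_⟩
    obtain ⟨c, rfl⟩ := Ideal.mem_span_singleton'.1 ha
    apply Subtype.ext
    change (c * b) • (m : M) = 0
    rw [mul_smul, hbT m m.2, smul_zero]
  · by_contra! h
    exact hproj (IsRegularlyWeaklyBased.projective_and_bounded h).1
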